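/- **Definitions.** Write $|p|$ for the length of a finite binary string $p$. A *prefix-free machine* is a partial computable function $A:\{0,1\}^*\rightharpoonup\{0,1\}^*$ such that no string in $\operatorname{dom} A$ is a proper prefix of another string in $\operatorname{dom} A$. Let $K_A(x)=\min\{|p| : A(p)=x\}$, with $K_A(x)=+\infty$ if there is no such $p$. A prefix-free machine $U$ is *universal* if for every prefix-free machine $A$ there is a constant $c$ with $K_U(x)\le K_A(x)+c$ for all $x$; one then writes $H=K_U$. For a finite string $u$ let $I_u\subseteq\{0,1\}^{\mathbb N}$ be the set of infinite sequences that extend $u$, and let $\mathrm{Proba}$ be the uniform (fair coin) probability measure on $\{0,1\}^{\mathbb N}$. A set $X\subseteq\{0,1\}^{\mathbb N}$ is *constructively of probability zero* if there is a partial computable function $(n,m)\mapsto u_{n,m}\in\{0,1\}^*$ such that $X\subseteq\bigcap_n\bigcup_m I_{u_{n,m}}$ and $\mathrm{Proba}\bigl(\bigcup_m I_{u_{n,m}}\bigr)\le 2^{-n}$ for all $n\in\mathbb N$ (the unions are over those $m$ for which $u_{n,m}$ is defined). A sequence is *Martin-Löf random* if it belongs to no set that is constructively of probability zero. **Theorem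 (the binary expansion of $\Omega$ is Martin-Löf random).** Let $U$ be a universal prefix-free machine. Then the series $$\Omega=\sum_{p\in\operatorname{dom} U}2^{-|p|}$$ converges, and there is exactly one sequence $\omega_0\omega_1\omega_2\ldots\in\{0,1\}^{\mathbb N}$ with $\Omega=\sum_{k\ge 0}\omega_k2^{-(k+1)}$. This sequence is Martin-Löf random, and there is a constant $c$ such that $H(\omega_0\ldots\omega_k)\ge k-c$ for all $k\in\mathbb N$. -/

import Mathlib

namespace AlgRandom

/-- A set of binary strings is prefix-free if no element is a proper prefix of another element. -/
def IsPrefixFree (Z : Set (List Bool)) : Prop :=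
  ∀ p ∈ Z, ∀ q ∈ Z, p <+: q → p = q

/-- A prefix-free machine: a partial computable function on binary strings whose domain
is prefix-free. -/
structure IsPrefixMachine (A : List Bool →. List Bool) : Prop where
  partrec : Partrec A
  prefixFree : IsPrefixFree A.Dom

/-- `K_A(x) = min {|p| : A(p) = x}`, equal to `⊤` if `x` is not in the range of `A`. -/
noncomputable def complexity (A : List Bool →. List Bool) (x : List Bool) : ℕ∞ :=
  ⨅ p ∈ {p : List Bool | x ∈ A p}, (p.length : ℕ∞)

/-- A universal prefix-free machine `U`: for every prefix-free machine `A` one has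
`K_U ≤ K_A + O(1)`. The function `complexity U` is then the prefix Kolmogorov complexity `H`. -/
structure IsUniversalPrefixMachine (U : List Bool →. List Bool) : Prop where
  isPrefixMachine : IsPrefixMachine U
  invariance : ∀ A : List Bool →. List Bool, IsPrefixMachine A →
    ∃ c : ℕ, ∀ x : List Bool, complexity U x ≤ complexity A x + c

/-- The weight `2^{-|p|}` of a program `p`. -/
noncomputable def weight (p : List Bool) : ℝ := (1 / 2 : ℝ) ^ p.length

/-- The halting probability `Ω = ∑_{p ∈ dom U} 2^{-|p|}`. -/
noncomputable def haltingProb (U : List Bool →. List Bool) : ℝ :=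
  ∑' p : U.Dom, weight p

/-- The finite string `a_0 a_1 … a_{n-1}`. -/
def initSeg (a : ℕ → Bool) (n : ℕ) : List Bool := (List.range n).map a

/-- The set `I_u` of infinite binary sequences that extend the finite string `u`. -/
def extensions (u : List Bool) : Set (ℕ → Bool) := {a | initSeg a u.length = u}

/-- The uniform probability measure on infinite binary sequences (independent fair bits). -/
noncomputable def coinMeasure : MeasureTheory.Measure (ℕ → Bool) :=
  MeasureTheory.Measure.infinitePi fun _ => (PMF.uniformOfFintype Bool).toMeasure

/-- The open set `⋃_m I_{u_m}` given by a partial sequence of strings; an undefined `u_m`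
contributes nothing. -/
def openSet (u : ℕ →. List Bool) : Set (ℕ → Bool) := ⋃ m, ⋃ v ∈ u m, extensions v

/-- `X` is constructively of probability zero: `X ⊆ ⋂_n ⋃_m I_{u_{n,m}}` for some partial computable
`(n, m) ↦ u_{n,m}` with `Proba (⋃_m I_{u_{n,m}}) ≤ 2^{-n}` for all `n`. -/
def IsConstructivelyNull (X : Set (ℕ → Bool)) : Prop :=
  ∃ u : ℕ → ℕ →. List Bool, Partrec₂ u ∧ X ⊆ (⋂ n, openSet (u n)) ∧
    ∀ n : ℕ, coinMeasure (openSet (u n)) ≤ (1 / 2 : ENNReal) ^ n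

/-- A sequence is Martin-Löf random if it lies in no set that is constructively of
probability zero. -/
def IsMartinLofRandom (a : ℕ → Bool) : Prop :=
  ∀ X : Set (ℕ → Bool), IsConstructivelyNull X → a ∉ X

/-- `a_0 a_1 a_2 …` is a binary expansion of `r`: `r = ∑_k a_k 2^{-(k+1)}`. -/
def IsBinaryExpansion (a : ℕ → Bool) (r : ℝ) : Prop :=
  HasSum (fun k : ℕ => if a k then (1 / 2 : ℝ) ^ (k + 1) else 0) r

end AlgRandom

/-! Kraft's inequality holds because the cylinders of a prefix-free set are disjoint; so the series
converges and `Ω ≤ 1`. Let `ω` be the expansion of `Ω` with infinitely many ones, so that `0.ω₀…ωₙ₋₁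
< Ω ≤ 0.ω₀…ωₙ₋₁ + 2⁻ⁿ`.

Incompressibility (`exists_machine_of_approx`, `length_le_of_approx`): from a program `p` for such a
segment `x` of length `n`, compute `x` and enumerate halting programs until their weight exceeds
`0.x`. The strict inequality makes this wait finite, and a program that halts only later has weight
below `2⁻ⁿ`. A string avoiding all outputs found so far therefore has no program of length below
`n`, yet it is computed from `p`; universality gives `n ≤ |p| + c`.

Uniqueness (`not_dyadic`): if `Ω` were dyadic, `ω` would end in ones and have compressible initial
segments. A non-dyadic real has one expansion.

Randomness (`IsUniversalPrefixMachine.isMartinLofRandom`): if `ω` lies in level `2n` of a test, list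
the strings of length `t` seen to be covered by stage `t`. There are at most `2^(t-2n)`, so an index
takes `t - 2n` bits. With children of earlier entries listed first, the indices of new entries form
a prefix-free code. The first segment of `ω` to be listed has, for its length `t`, a program of
length at most `t - n + d`, which contradicts incompressibility for large `n`. -/

open MeasureTheory

namespace AlgRandom

/-! ### Binary strings as numerals. -/

/-- The natural number with binary digits `l`, most significant digit first. -/
def binVal (l : List Bool) : ℕ := l.foldl (fun n b => 2 * n + b.toNat) 0

@[simp] theorem binVal_nil : binVal [] = 0 := rfl

theorem binVal_concat (l : List Bool) (b : Bool) : binVal (l ++ [b]) = 2 * binVal l + b.toNat := by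
  simp [binVal]

theorem binVal_append (l r : List Bool) :
    binVal (l ++ r) = binVal l * 2 ^ r.length + binVal r := by
  induction r using List.reverseRecOn with
  | nil => simp
  | append_singleton r b ih =>
    rw [← List.append_assoc, binVal_concat, ih, binVal_concat]
    simp [pow_succ]
    ring

theorem binVal_lt (l : List Bool) : binVal l < 2 ^ l.length := by
  induction l using List.reverseRecOn with
  | nil => simp
  | append_singleton r b ih =>
    have := Bool.toNat_le b
    simp only [binVal_concat, List.length_append, List.length_singleton, pow_succ]
    omega

theorem binVal_inj {l r : List Bool} (h : l.length = r.length) (hv : binVal l = binVal r) :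
    l = r := by
  induction l using List.reverseRecOn generalizing r with
  | nil => simpa [eq_comm] using h
  | append_singleton l b ih =>
    induction r using List.reverseRecOn with
    | nil => simp at h
    | append_singleton r d _ =>
      simp only [binVal_concat] at hv
      have hbd : b = d ∧ binVal l = binVal r := by
        cases b <;> cases d <;> simp at hv ⊢ <;> omega
      rw [ih (by simpa using h) hbd.2, hbd.1]

theorem exists_binVal_eq (n : ℕ) : ∀ N < 2 ^ n, ∃ l : List Bool, l.length = n ∧ binVal l = N := by
  induction n with
  | zero => intro N hN; exact ⟨[], rfl, by simp at hN; simp [hN]⟩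
  | succ n ih =>
    intro N hN
    obtain ⟨l, hl, hv⟩ := ih (N / 2) (by rw [pow_succ] at hN; omega)
    refine ⟨l ++ [decide (N % 2 = 1)], by simp [hl], ?_⟩
    rw [binVal_concat, hv]
    rcases Nat.mod_two_eq_zero_or_one N with h | h <;> simp [h] <;> omega

theorem binVal_replicate_true (k : ℕ) : binVal (List.replicate k true) + 1 = 2 ^ k := by
  induction k with
  | zero => simp
  | succ k ih =>
    rw [List.replicate_succ', binVal_concat, pow_succ]
    simp
    omega

/-- The list of all binary strings of length `n`. -/
def strings : ℕ → List (List Bool)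
  | 0 => [[]]
  | n + 1 => (strings n).flatMap fun z => [z ++ [false], z ++ [true]]

theorem mem_strings {n : ℕ} {l : List Bool} : l ∈ strings n ↔ l.length = n := by
  induction n generalizing l with
  | zero => simp [strings]
  | succ n ih =>
    induction l using List.reverseRecOn with
    | nil => simp [strings]
    | append_singleton l b _ => cases b <;> simp [strings, ih]

theorem nodup_flatMap_children {L : List (List Bool)} (h : L.Nodup) :
    (L.flatMap fun z => [z ++ [false], z ++ [true]]).Nodup := by
  rw [List.nodup_flatMap]
  refine ⟨fun x _ => by simp, h.imp fun {a b} hab => ?_⟩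
  simp [Function.onFun, Ne.symm hab]

theorem nodup_strings (n : ℕ) : (strings n).Nodup := by
  induction n with
  | zero => simp [strings]
  | succ n ih => exact nodup_flatMap_children ih

theorem length_flatMap_children (L : List (List Bool)) :
    (L.flatMap fun z => [z ++ [false], z ++ [true]]).length = 2 * L.length := by
  simp [mul_comm]

/-! ### Initial segments, cylinders and Kraft's inequality. -/

@[simp] theorem length_initSeg (a : ℕ → Bool) (n : ℕ) : (initSeg a n).length = n := by
  simp [initSeg]

theorem initSeg_succ (a : ℕ → Bool) (n : ℕ) : initSeg a (n + 1) = initSeg a n ++ [a n] := by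
  simp [initSeg, List.range_succ]

theorem initSeg_prefix (a : ℕ → Bool) {m n : ℕ} (h : m ≤ n) : initSeg a m <+: initSeg a n := by
  obtain ⟨k, rfl⟩ := Nat.exists_eq_add_of_le h
  simp [initSeg, List.range_add]

theorem initSeg_inj {a b : ℕ → Bool} (h : ∀ n, initSeg a n = initSeg b n) : a = b := by
  funext n
  simpa [initSeg_succ, h n] using h (n + 1)

theorem mem_extensions_iff_prefix {a : ℕ → Bool} {u : List Bool} :
    a ∈ extensions u ↔ ∃ n, u <+: initSeg a n := by
  refine ⟨fun h => ⟨u.length, by rw [show initSeg a u.length = u from h]⟩, fun ⟨n, h⟩ => ?_⟩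
  have hle : u.length ≤ n := by simpa using h.length_le
  exact (List.prefix_of_prefix_length_le (initSeg_prefix a hle) h (by simp)).eq_of_length (by simp)

theorem mem_extensions_of_prefix {a : ℕ → Bool} {u v : List Bool} (h : u <+: v)
    (ha : a ∈ extensions v) : a ∈ extensions u := by
  obtain ⟨n, hn⟩ := mem_extensions_iff_prefix.1 ha
  exact mem_extensions_iff_prefix.2 ⟨n, h.trans hn⟩

theorem prefix_or_prefix_of_mem_extensions {a : ℕ → Bool} {u v : List Bool}
    (hu : a ∈ extensions u) (hv : a ∈ extensions v) : u <+: v ∨ v <+: u := by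
  have hu' : initSeg a u.length = u := hu
  have hv' : initSeg a v.length = v := hv
  rcases le_total u.length v.length with h | h
  · left; simpa only [hu', hv'] using initSeg_prefix a h
  · right; simpa only [hu', hv'] using initSeg_prefix a h

/-- This box form lets the product measure be evaluated; the default `false` is never reached. -/
theorem extensions_eq_pi (u : List Bool) :
    extensions u = Set.pi (Finset.range u.length) fun i => {u.getD i false} := by
  ext a
  simp only [extensions, initSeg, Set.mem_ofPred_eq, Set.mem_pi, Finset.coe_range, Set.mem_Iio,
    Set.mem_singleton_iff]
  constructor
  · intro h i hi
    rw [← h]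
    simp [hi]
  · intro h
    refine List.ext_getElem (by simp) fun i h1 h2 => ?_
    simp [h i h2, h2]

theorem measurableSet_extensions (u : List Bool) : MeasurableSet (extensions u) := by
  rw [extensions_eq_pi]
  exact MeasurableSet.pi (Finset.countable_toSet _) fun i _ => MeasurableSet.singleton _

theorem coinMeasure_extensions (u : List Bool) :
    coinMeasure (extensions u) = (1 / 2 : ENNReal) ^ u.length := by
  rw [extensions_eq_pi, coinMeasure, Measure.infinitePi_pi _ fun i _ => MeasurableSet.singleton _]
  simp

instance : IsProbabilityMeasure coinMeasure := by
  unfold coinMeasure; infer_instance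

theorem IsPrefixFree.pairwise_disjoint {Z : Set (List Bool)} (hZ : IsPrefixFree Z) :
    Pairwise (Function.onFun Disjoint fun p : Z => extensions p) := by
  intro p q hpq
  refine Set.disjoint_left.2 fun a ha hb => hpq (Subtype.ext ?_)
  rcases prefix_or_prefix_of_mem_extensions ha hb with h | h
  · exact hZ _ p.2 _ q.2 h
  · exact (hZ _ q.2 _ p.2 h).symm

theorem IsPrefixFree.tsum_extensions {Z : Set (List Bool)} (hZ : IsPrefixFree Z) :
    ∑' p : Z, (1 / 2 : ENNReal) ^ p.1.length ≤ 1 := by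
  simp_rw [← coinMeasure_extensions]
  rw [← measure_iUnion hZ.pairwise_disjoint fun p => measurableSet_extensions p]
  exact prob_le_one

/-- Kraft's inequality, convergence part. -/
theorem IsPrefixFree.summable_weight {Z : Set (List Bool)} (hZ : IsPrefixFree Z) :
    Summable fun p : Z => weight p := by
  have := ENNReal.summable_toReal (ne_top_of_le_ne_top ENNReal.one_ne_top hZ.tsum_extensions)
  simpa [weight] using this

/-- Kraft's inequality. -/
theorem IsPrefixFree.tsum_weight_le_one {Z : Set (List Bool)} (hZ : IsPrefixFree Z) :
    ∑' p : Z, weight p ≤ 1 := by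
  have h := ENNReal.toReal_mono ENNReal.one_ne_top hZ.tsum_extensions
  rw [ENNReal.tsum_toReal_eq fun p => by finiteness] at h
  simpa [weight] using h

/-- Distinct strings of equal length have disjoint cylinders, so the measure bound becomes a count.
This bounds the number of digits needed for an index. -/
theorem length_mul_le_of_extensions_subset {L : List (List Bool)} {t k : ℕ} (hL : L.Nodup)
    (hlen : ∀ z ∈ L, z.length = t) {O : Set (ℕ → Bool)} (hO : ∀ z ∈ L, extensions z ⊆ O)
    (hμ : coinMeasure O ≤ (1 / 2 : ENNReal) ^ k) : L.length * 2 ^ k ≤ 2 ^ t := by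
  have hdisj : (L.toFinset : Set (List Bool)).PairwiseDisjoint extensions := by
    intro p hp q hq hpq
    refine Set.disjoint_left.2 fun a ha hb => hpq ?_
    have hp' : initSeg a p.length = p := ha
    have hq' : initSeg a q.length = q := hb
    rw [← hp', ← hq', hlen p (by simpa using hp), hlen q (by simpa using hq)]
  have h1 : (L.length : ENNReal) * (1 / 2) ^ t ≤ (1 / 2) ^ k := by
    have hsub : (⋃ z ∈ L.toFinset, extensions z) ⊆ O :=
      Set.iUnion₂_subset fun z hz => hO z (by simpa using hz)
    refine le_trans ?_ ((measure_mono hsub).trans hμ)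
    rw [measure_biUnion_finset hdisj fun z _ => measurableSet_extensions z,
      Finset.sum_congr rfl fun z hz => by
        rw [coinMeasure_extensions, hlen z (by simpa using hz)],
      Finset.sum_const, List.toFinset_card_of_nodup hL, nsmul_eq_mul]
  have h2 := ENNReal.toReal_mono (by finiteness) h1
  simp only [one_div, ENNReal.toReal_mul, ENNReal.toReal_natCast, ENNReal.toReal_pow,
    ENNReal.toReal_inv, ENNReal.toReal_ofNat, inv_pow] at h2
  rw [← div_eq_mul_inv, div_le_iff₀ (by positivity), ← div_eq_inv_mul,
    le_div_iff₀ (by positivity)] at h2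
  exact_mod_cast h2

/-! ### Complexity bounds in terms of programs. -/

theorem complexity_le {A : List Bool →. List Bool} {x p : List Bool} (h : x ∈ A p) :
    complexity A x ≤ p.length :=
  iInf₂_le p h

theorem le_complexity_add {A : List Bool →. List Bool} {x : List Bool} {n c : ℕ}
    (h : ∀ p, x ∈ A p → n ≤ p.length + c) : (n : ℕ∞) ≤ complexity A x + c := by
  by_cases hx : ∃ p, x ∈ A p
  · obtain ⟨p, hp⟩ := hx
    rw [← tsub_le_iff_right]
    refine le_iInf₂ fun q hq => ?_
    rw [tsub_le_iff_right]
    exact_mod_cast h q hq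
  · have : complexity A x = ⊤ := by
      simp only [complexity, Set.mem_ofPred_eq, iInf_eq_top]
      exact fun p hp => absurd ⟨p, hp⟩ hx
    simp [this]

theorem exists_program_of_complexity_le {A : List Bool →. List Bool} {x : List Bool} {n : ℕ}
    (h : complexity A x ≤ n) : ∃ p, x ∈ A p ∧ p.length ≤ n := by
  by_contra! hlt
  have h1 : ((n + 1 : ℕ) : ℕ∞) ≤ complexity A x :=
    le_iInf₂ fun p hp => by exact_mod_cast hlt p hp
  have h2 : n + 1 ≤ n := by exact_mod_cast h1.trans h
  omega

/-! ### Finite approximations and primitive recursiveness. -/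

open Nat.Partrec (Code)

/-- A partial computable function is the increasing union of primitive recursive
finite approximations. -/
theorem exists_primrec_approx {α β : Type*} [Primcodable α] [Primcodable β] {f : α →. β}
    (hf : Partrec f) : ∃ g : ℕ → α → Option β, Primrec₂ g ∧
      (∀ s t a b, s ≤ t → g s a = some b → g t a = some b) ∧
      ∀ a b, b ∈ f a ↔ ∃ s, g s a = some b := by
  obtain ⟨c, hc⟩ := Code.exists_code.1 hf
  refine ⟨fun s a => (Code.evaln s c (Encodable.encode a)).bind Encodable.decode, ?_, ?_, ?_⟩
  · refine Primrec.option_bind (Code.primrec_evaln.comp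
      ((Primrec.fst.pair (Primrec.const c)).pair (Primrec.encode.comp Primrec.snd)))
      (Primrec.decode.comp Primrec.snd)
  · intro s t a b hst h
    obtain ⟨n, hn, hb⟩ := Option.bind_eq_some_iff.1 h
    exact Option.bind_eq_some_iff.2 ⟨n, Code.evaln_mono hst hn, hb⟩
  · intro a b
    have key : ∀ n, n ∈ Code.eval c (Encodable.encode a) ↔ ∃ b ∈ f a, Encodable.encode b = n := by
      intro n; rw [hc]; simp
    constructor
    · intro h
      obtain ⟨s, hs⟩ := Code.evaln_complete.1 ((key _).2 ⟨b, h, rfl⟩)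
      exact ⟨s, Option.bind_eq_some_iff.2 ⟨_, hs, by simp⟩⟩
    · rintro ⟨s, hs⟩
      obtain ⟨n, hn, hb⟩ := Option.bind_eq_some_iff.1 hs
      obtain ⟨b', hb', rfl⟩ := (key _).1 (Code.evaln_sound hn)
      simp only [Encodable.encodek, Option.some.injEq] at hb
      exact hb ▸ hb'

theorem primrec_pow : Primrec₂ ((· ^ ·) : ℕ → ℕ → ℕ) :=
  Primrec₂.unpaired'.1 Nat.Primrec.pow

theorem primrec_binVal : Primrec binVal := by
  refine Primrec.list_foldl (h := fun _ (x : ℕ × Bool) => 2 * x.1 + x.2.toNat) Primrec.id (Primrec.const 0) ?_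
  exact Primrec.nat_add.comp (Primrec.nat_double.comp (Primrec.fst.comp Primrec.snd))
    ((Primrec.dom_finite Bool.toNat).comp (Primrec.snd.comp Primrec.snd))

theorem primrec_children : Primrec fun z : List Bool => [z ++ [false], z ++ [true]] :=
  Primrec.list_cons.comp (Primrec.list_concat.comp .id (.const false))
    (Primrec.list_cons.comp (Primrec.list_concat.comp .id (.const true)) (.const []))

theorem primrec_strings : Primrec strings := by
  refine (Primrec.nat_rec₁ (f := fun _ L => L.flatMap fun z : List Bool =>
    [z ++ [false], z ++ [true]]) [[]]
    (Primrec.list_flatMap Primrec.snd (primrec_children.comp₂ Primrec₂.right)).to₂).of_eq fun n => ?_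
  induction n with
  | zero => rfl
  | succ n ih => simp only [strings, ih]

theorem primrec_dropLast {α : Type*} [Primcodable α] : Primrec (List.dropLast : List α → List α) :=
  (Primrec.list_take.comp (Primrec.nat_sub.comp Primrec.list_length (.const 1)) .id).of_eq
    fun l => by simp [List.dropLast_eq_take]

theorem primrec_list_mem {α : Type*} [Primcodable α] [DecidableEq α] :
    PrimrecRel fun (a : α) (l : List α) => a ∈ l :=
  PrimrecPred.of_eq (Primrec.nat_lt.comp Primrec.list_idxOf (Primrec.list_length.comp Primrec.snd))
    fun _ => List.idxOf_lt_length_iff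

theorem primrec_prefix : PrimrecRel fun u v : List Bool => u <+: v :=
  PrimrecPred.of_eq (Primrec.eq.comp Primrec.fst
    (Primrec.list_take.comp (Primrec.list_length.comp Primrec.fst) Primrec.snd))
    fun _ => List.prefix_iff_eq_take.symm

theorem primrec_list_sum : Primrec (List.sum : List ℕ → ℕ) :=
  (Primrec.list_foldr (h := fun _ x => x.1 + x.2) Primrec.id (Primrec.const 0)
    (Primrec.nat_add.comp (Primrec.fst.comp Primrec.snd) (Primrec.snd.comp Primrec.snd))).of_eq
    fun l => by induction l <;> simp_all

/-! ### Lists of covered strings. -/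

/-- The strings of length `t` having a prefix that satisfies `C` at the stage equal to its length,
listed so that the strings whose proper prefixes already had this property come first. -/
def coverList (C : ℕ → List Bool → Bool) : ℕ → List (List Bool)
  | 0 => []
  | t + 1 => ((coverList C t).flatMap fun z => [z ++ [false], z ++ [true]]) ++
      (strings (t + 1)).filter fun z => C (t + 1) z && !decide (z.dropLast ∈ coverList C t)

theorem length_of_mem_coverList {C : ℕ → List Bool → Bool} {t : ℕ} {z : List Bool}
    (h : z ∈ coverList C t) : z.length = t := by
  induction t generalizing z with
  | zero => simp [coverList] at h
  | succ t ih =>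
    simp only [coverList, List.mem_append, List.mem_flatMap, List.mem_filter] at h
    rcases h with ⟨y, hy, h⟩ | h
    · rcases (by simpa using h : z = y ++ [false] ∨ z = y ++ [true]) with rfl | rfl <;>
        simp [ih hy]
    · exact mem_strings.1 h.1

theorem mem_flatMap_children {L : List (List Bool)} {z : List Bool} :
    (z ∈ L.flatMap fun z => [z ++ [false], z ++ [true]]) ↔ z ≠ [] ∧ z.dropLast ∈ L := by
  induction z using List.reverseRecOn with
  | nil => simp
  | append_singleton z b _ => cases b <;> simp

theorem mem_coverList_succ {C : ℕ → List Bool → Bool} {t : ℕ} {z : List Bool} :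
    z ∈ coverList C (t + 1) ↔ z.length = t + 1 ∧ (z.dropLast ∈ coverList C t ∨ C (t + 1) z) := by
  simp only [coverList, List.mem_append, mem_flatMap_children, List.mem_filter, mem_strings,
    Bool.and_eq_true, Bool.not_eq_true', decide_eq_false_iff_not]
  constructor
  · rintro (⟨h1, h2⟩ | h)
    · have := length_of_mem_coverList h2
      have := List.length_pos_iff.2 h1
      simp at *
      exact ⟨by omega, .inl h2⟩
    · exact ⟨h.1, .inr h.2.1⟩
  · rintro ⟨h1, h2⟩
    have : z ≠ [] := by rintro rfl; simp at h1
    tauto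

theorem nodup_coverList (C : ℕ → List Bool → Bool) (t : ℕ) : (coverList C t).Nodup := by
  induction t with
  | zero => simp [coverList]
  | succ t ih =>
    refine List.Nodup.append (nodup_flatMap_children ih) ((nodup_strings _).filter _) ?_
    intro z hz hz'
    rw [mem_flatMap_children] at hz
    simp [hz.2] at hz'

theorem two_mul_length_coverList_le (C : ℕ → List Bool → Bool) (t : ℕ) :
    2 * (coverList C t).length ≤ (coverList C (t + 1)).length := by
  rw [coverList, List.length_append, length_flatMap_children]
  exact Nat.le_add_right _ _

/-- Both children of a listed string stay listed, so the listed proportion of strings never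
decreases with the length. This keeps the codes of new strings at different lengths apart. -/
theorem pow_mul_length_coverList_le (C : ℕ → List Bool → Bool) (t k : ℕ) :
    2 ^ k * (coverList C t).length ≤ (coverList C (t + k)).length := by
  induction k with
  | zero => simp
  | succ k ih =>
    have := two_mul_length_coverList_le C (t + k)
    rw [pow_succ, ← add_assoc]
    nlinarith

/-- A string whose parent is not listed has a large index in the next list. -/
theorem le_index_coverList {C : ℕ → List Bool → Bool} {t N : ℕ} {z : List Bool}
    (h : (coverList C (t + 1))[N]? = some z) (hz : z.dropLast ∉ coverList C t) :
    2 * (coverList C t).length ≤ N := by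
  by_contra! hN
  rw [← length_flatMap_children] at hN
  rw [coverList, List.getElem?_append_left hN] at h
  exact hz (mem_flatMap_children.1 (List.mem_of_getElem? h)).2

theorem exists_prefix_of_mem_coverList {C : ℕ → List Bool → Bool} {t : ℕ} {z : List Bool}
    (h : z ∈ coverList C t) : ∃ k ≤ t, ∃ y, y <+: z ∧ C k y := by
  induction t generalizing z with
  | zero => simp [coverList] at h
  | succ t ih =>
    rcases (mem_coverList_succ.1 h).2 with h | h
    · obtain ⟨k, hk, y, hy, hC⟩ := ih h
      exact ⟨k, by omega, y, hy.trans (List.dropLast_prefix z), hC⟩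
    · exact ⟨t + 1, le_rfl, z, List.prefix_rfl, h⟩

theorem primrec_coverList {C : ℕ → ℕ → List Bool → Bool}
    (hC : Primrec fun x : (ℕ × ℕ) × List Bool => C x.1.1 x.1.2 x.2) :
    Primrec₂ fun n t => coverList (C n) t := by
  have hrec : Primrec₂ fun (n : ℕ) (x : ℕ × List (List Bool)) =>
      (x.2.flatMap fun z => [z ++ [false], z ++ [true]]) ++
      (strings (x.1 + 1)).filter fun z => C n (x.1 + 1) z && !decide (z.dropLast ∈ x.2) := by
    refine Primrec.list_append.comp (Primrec.list_flatMap (Primrec.snd.comp Primrec.snd)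
      (primrec_children.comp₂ Primrec₂.right)) ?_
    have hR : PrimrecRel fun (z : List Bool) (y : ℕ × ℕ × List (List Bool)) =>
        C y.1 (y.2.1 + 1) z = true ∧ ¬ z.dropLast ∈ y.2.2 := by
      refine PrimrecPred.and (Primrec.eq.comp ?_ (.const true)) (PrimrecPred.not ?_)
      · exact hC.comp (((Primrec.fst.comp Primrec.snd).pair (Primrec.succ.comp
          (Primrec.fst.comp (Primrec.snd.comp Primrec.snd)))).pair Primrec.fst)
      · exact primrec_list_mem.comp (primrec_dropLast.comp Primrec.fst)
          (Primrec.snd.comp (Primrec.snd.comp Primrec.snd))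
    refine (hR.listFilter.comp (primrec_strings.comp (Primrec.succ.comp
      (Primrec.fst.comp Primrec.snd))) Primrec.id).of_eq fun x => ?_
    refine List.filter_congr fun z _ => ?_
    simp
  refine (Primrec.nat_rec (Primrec.const []) hrec).of_eq fun n t => ?_
  induction t with
  | zero => rfl
  | succ t ih => simp only [coverList] at ih ⊢; rw [ih]

/-! ### Approximation of `Ω` from below. -/

theorem weight_nonneg (p : List Bool) : 0 ≤ weight p := by unfold weight; positivity

theorem IsPrefixMachine.summable_indicator {U : List Bool →. List Bool} (hU : IsPrefixMachine U) :
    Summable (U.Dom.indicator weight) :=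
  summable_subtype_iff_indicator.1 hU.prefixFree.summable_weight

theorem haltingProb_eq_tsum_indicator (U : List Bool →. List Bool) :
    haltingProb U = ∑' p, U.Dom.indicator weight p :=
  tsum_subtype U.Dom weight

theorem IsPrefixMachine.sum_weight_le {U : List Bool →. List Bool} (hU : IsPrefixMachine U)
    {T : Finset (List Bool)} (hT : ∀ p ∈ T, p ∈ U.Dom) : ∑ p ∈ T, weight p ≤ haltingProb U := by
  rw [haltingProb_eq_tsum_indicator]
  refine le_trans (le_of_eq (Finset.sum_congr rfl fun p hp => ?_))
    (hU.summable_indicator.sum_le_tsum T fun p _ =>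
      Set.indicator_nonneg (fun p _ => weight_nonneg p) p)
  rw [Set.indicator_of_mem (hT p hp)]

/-- The programs of length at most `s` that are seen to halt at stage `s` of the
approximation `g`. -/
def haltedAt (g : ℕ → List Bool → Option (List Bool)) (s : ℕ) : List (List Bool) :=
  ((List.range (s + 1)).flatMap strings).filter fun p => (g s p).isSome

/-- The weight of the programs seen to halt at stage `s`, scaled by `2 ^ s`. -/
def haltedSum (g : ℕ → List Bool → Option (List Bool)) (s : ℕ) : ℕ :=
  ((haltedAt g s).map fun p => 2 ^ (s - p.length)).sum

/-- A string that differs from the outputs of all programs seen to halt at stage `s`. -/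
def freshString (g : ℕ → List Bool → Option (List Bool)) (s : ℕ) : List Bool :=
  true :: (haltedAt g s).flatMap fun p => (g s p).getD []

section Stage

variable {g : ℕ → List Bool → Option (List Bool)} {s : ℕ} {p : List Bool}

theorem mem_haltedAt : p ∈ haltedAt g s ↔ p.length ≤ s ∧ (g s p).isSome := by
  simp [haltedAt, mem_strings]

theorem nodup_haltedAt : (haltedAt g s).Nodup := by
  refine List.Nodup.filter _ (List.nodup_flatMap.2 ⟨fun n _ => nodup_strings n, ?_⟩)
  refine List.nodup_range.imp fun {a b} hab => ?_
  intro z hz hz'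
  exact hab ((mem_strings.1 hz).symm.trans (mem_strings.1 hz'))

theorem haltedSum_eq : (haltedSum g s : ℝ) = 2 ^ s * ∑ p ∈ (haltedAt g s).toFinset, weight p := by
  rw [haltedSum, ← List.sum_toFinset _ nodup_haltedAt, Finset.mul_sum, Nat.cast_sum]
  refine Finset.sum_congr rfl fun p hp => ?_
  have hp' : p.length ≤ s := (mem_haltedAt.1 (List.mem_toFinset.1 hp)).1
  obtain ⟨k, rfl⟩ := Nat.exists_eq_add_of_le hp'
  simp [weight, pow_add]
  field_simp

/-- The fresh string is longer than the concatenation of all these outputs, hence longer than each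
of them. -/
theorem ne_freshString (hp : p ∈ haltedAt g s) : g s p ≠ some (freshString g s) := by
  intro h
  have h1 : ((g s p).getD []).length ≤
      ((haltedAt g s).flatMap fun p => (g s p).getD []).length := by
    rw [List.flatMap_def]
    exact (List.sublist_flatten_of_mem
      (List.mem_map_of_mem (f := fun p => (g s p).getD []) hp)).length_le
  rw [h] at h1
  simp [freshString] at h1

theorem primrec_haltedAt (hg : Primrec₂ g) : Primrec (haltedAt g) := by
  have hR : PrimrecRel fun (p : List Bool) (s : ℕ) => (g s p).isSome = true :=
    Primrec.eq.comp (Primrec.option_isSome.comp (hg.comp Primrec.snd Primrec.fst)) (.const true)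
  refine (hR.listFilter.comp (Primrec.list_flatMap (Primrec.list_range.comp Primrec.succ)
    (primrec_strings.comp₂ Primrec₂.right)) Primrec.id).of_eq fun s => ?_
  simp [haltedAt]

theorem primrec_haltedSum (hg : Primrec₂ g) : Primrec (haltedSum g) :=
  primrec_list_sum.comp (Primrec.list_map (primrec_haltedAt hg)
    (primrec_pow.comp (.const 2) (Primrec.nat_sub.comp Primrec.fst
      (Primrec.list_length.comp Primrec.snd))).to₂)

theorem primrec_freshString (hg : Primrec₂ g) : Primrec (freshString g) :=
  Primrec.list_cons.comp (.const true) (Primrec.list_flatMap (primrec_haltedAt hg)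
    (Primrec.option_getD.comp hg (.const [])).to₂)

theorem mem_dom_of_mem_haltedAt {U : List Bool →. List Bool}
    (hspec : ∀ p x, x ∈ U p ↔ ∃ s, g s p = some x) (h : p ∈ haltedAt g s) : p ∈ U.Dom := by
  obtain ⟨x, hx⟩ := Option.isSome_iff_exists.1 (mem_haltedAt.1 h).2
  exact Part.dom_iff_mem.2 ⟨x, (hspec p x).2 ⟨s, hx⟩⟩

/-- Finitely many halting programs already have weight above `0.x`, and all of them are seen from
some stage on. This is why the search in the machine below terminates. -/
theorem exists_lt_haltedSum {U : List Bool →. List Bool} (hU : IsPrefixMachine U)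
    (hspec : ∀ p x, x ∈ U p ↔ ∃ s, g s p = some x)
    (hmono : ∀ s t p x, s ≤ t → g s p = some x → g t p = some x) {x : List Bool}
    (hx : (binVal x : ℝ) < 2 ^ x.length * haltingProb U) :
    ∃ s, binVal x * 2 ^ s < 2 ^ x.length * haltedSum g s := by
  have hr : (binVal x : ℝ) / 2 ^ x.length < haltingProb U := by
    rw [div_lt_iff₀ (by positivity)]; linarith
  have hsum := hU.summable_indicator.hasSum
  rw [← haltingProb_eq_tsum_indicator] at hsum
  obtain ⟨T, hT⟩ := (hsum.eventually (lt_mem_nhds hr)).exists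
  have hev : ∀ᶠ s in Filter.atTop, ∀ p ∈ T, p ∈ U.Dom → p ∈ haltedAt g s := by
    refine (Filter.eventually_all_finset T).2 fun p _ => ?_
    by_cases hp : p ∈ U.Dom
    · obtain ⟨y, hy⟩ := Part.dom_iff_mem.1 hp
      obtain ⟨t, ht⟩ := (hspec p y).1 hy
      filter_upwards [Filter.eventually_ge_atTop t, Filter.eventually_ge_atTop p.length]
        with s h1 h2 _
      exact mem_haltedAt.2 ⟨h2, by simp [hmono t s p y h1 ht]⟩
    · exact Filter.Eventually.of_forall fun s h => absurd h hp
  obtain ⟨s, hs⟩ := hev.exists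
  refine ⟨s, ?_⟩
  have hle : ∑ p ∈ T, U.Dom.indicator weight p ≤ ∑ p ∈ (haltedAt g s).toFinset, weight p := by
    classical
    simp_rw [Set.indicator_apply]
    rw [← Finset.sum_filter]
    refine Finset.sum_le_sum_of_subset_of_nonneg (fun p hp => ?_) fun p _ _ => weight_nonneg p
    rw [Finset.mem_filter] at hp
    exact List.mem_toFinset.2 (hs p hp.1 hp.2)
  have h := hT.trans_le hle
  rw [div_lt_iff₀ (by positivity)] at h
  have h2 : (binVal x : ℝ) * 2 ^ s < 2 ^ x.length * haltedSum g s := by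
    rw [haltedSum_eq]
    have := mul_lt_mul_of_pos_right h (show (0 : ℝ) < 2 ^ s by positivity)
    linarith
  exact_mod_cast h2

/-- Adding `q` to the programs already seen keeps the total at most `Ω`, while less than `2^(-|x|)`
of the weight is still missing. -/
theorem length_lt_of_notMem_haltedAt {U : List Bool →. List Bool} (hU : IsPrefixMachine U)
    (hspec : ∀ p x, x ∈ U p ↔ ∃ s, g s p = some x) {x q : List Bool}
    (hs : binVal x * 2 ^ s < 2 ^ x.length * haltedSum g s)
    (hx : 2 ^ x.length * haltingProb U ≤ binVal x + 1) (hq : q ∈ U.Dom) (hqs : q ∉ haltedAt g s) :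
    x.length < q.length := by
  have h1 := hU.sum_weight_le (T := insert q (haltedAt g s).toFinset) fun p hp => by
    rcases Finset.mem_insert.1 hp with rfl | hp
    · exact hq
    · exact mem_dom_of_mem_haltedAt hspec (List.mem_toFinset.1 hp)
  rw [Finset.sum_insert (by simpa using hqs)] at h1
  have h2 : (binVal x : ℝ) * 2 ^ s < 2 ^ x.length * haltedSum g s := by exact_mod_cast hs
  rw [haltedSum_eq] at h2
  have h3 : (binVal x : ℝ) < 2 ^ x.length * ∑ p ∈ (haltedAt g s).toFinset, weight p := by
    refine lt_of_mul_lt_mul_right (a := (2 : ℝ) ^ s) ?_ (by positivity)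
    linarith
  have h4 : (2 : ℝ) ^ x.length * weight q < 1 := by
    have := mul_le_mul_of_nonneg_left h1 (show (0 : ℝ) ≤ 2 ^ x.length by positivity)
    rw [mul_add] at this
    linarith
  rw [weight, one_div, inv_pow, ← div_eq_mul_inv, div_lt_one (by positivity)] at h4
  exact (pow_lt_pow_iff_right₀ (by norm_num)).1 h4

end Stage

/-- Given a program for a lower approximation `0.x` of `Ω` within `2 ^ (-|x|)`, one can compute a
string without programs of length less than `|x|`. -/
theorem IsPrefixMachine.exists_machine_of_approx {U : List Bool →. List Bool}
    (hU : IsPrefixMachine U) : ∃ A, IsPrefixMachine A ∧ ∀ p x, x ∈ U p →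
      (binVal x : ℝ) < 2 ^ x.length * haltingProb U →
      2 ^ x.length * haltingProb U ≤ binVal x + 1 →
      ∃ y ∈ A p, ∀ q, y ∈ U q → x.length ≤ q.length := by
  obtain ⟨g, hg, hmono, hspec⟩ := exists_primrec_approx hU.partrec
  let test : List Bool → ℕ → Bool := fun x s =>
    decide (binVal x * 2 ^ s < 2 ^ x.length * haltedSum g s)
  have htest : Primrec₂ test :=
    (Primrec.nat_lt.comp
      (Primrec.nat_mul.comp (primrec_binVal.comp Primrec.fst)
        (primrec_pow.comp (.const 2) Primrec.snd))
      (Primrec.nat_mul.comp (primrec_pow.comp (.const 2) (Primrec.list_length.comp Primrec.fst))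
        ((primrec_haltedSum hg).comp Primrec.snd))).decide.to₂
  have hsearch : Partrec fun x => (Nat.rfind fun s => Part.some (test x s)).map (freshString g) :=
    Partrec.map (Partrec.rfind htest.to_comp.partrec₂)
      ((primrec_freshString hg).to_comp.comp Computable.snd).to₂
  refine ⟨fun p => (U p).bind fun x =>
    (Nat.rfind fun s => Part.some (test x s)).map (freshString g),
    ⟨hU.partrec.bind (hsearch.comp Computable.snd).to₂, ?_⟩, ?_⟩
  -- The new machine halts only on programs on which `U` halts, so its domain inherits
  -- prefix-freeness.
  · intro p hp q hq
    obtain ⟨hp, -⟩ := hp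
    obtain ⟨hq, -⟩ := hq
    exact hU.prefixFree p hp q hq
  · intro p x hx h1 h2
    obtain ⟨t, ht⟩ := exists_lt_haltedSum hU hspec hmono h1
    obtain ⟨s, hs, -⟩ := Nat.rfind_min' (p := test x) (m := t) (by simpa [test] using ht)
    have hs' : binVal x * 2 ^ s < 2 ^ x.length * haltedSum g s := by
      simpa [test] using Nat.rfind_spec hs
    refine ⟨freshString g s, Part.mem_bind hx (Part.mem_map _ hs), fun q hq => ?_⟩
    refine (length_lt_of_notMem_haltedAt hU hspec hs' h2 (Part.dom_iff_mem.2 ⟨_, hq⟩) ?_).le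
    intro hmem
    obtain ⟨y, hy⟩ := Option.isSome_iff_exists.1 (mem_haltedAt.1 hmem).2
    have : y = freshString g s := Part.mem_unique ((hspec q y).2 ⟨s, hy⟩) hq
    exact ne_freshString hmem (this ▸ hy)

/-! ### Binary expansions of real numbers. -/

theorem binVal_append_lt (l r : List Bool) : binVal (l ++ r) < (binVal l + 1) * 2 ^ r.length := by
  rw [binVal_append, add_mul, one_mul]
  exact Nat.add_lt_add_left (binVal_lt r) _

/-- The binary expansion with infinitely many ones of a real number in `(0, 1]`. -/
theorem exists_initSeg_approx {r : ℝ} (h0 : 0 < r) (h1 : r ≤ 1) :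
    ∃ ω : ℕ → Bool, ∀ n, (binVal (initSeg ω n) : ℝ) < 2 ^ n * r ∧
      2 ^ n * r ≤ binVal (initSeg ω n) + 1 := by
  have hm : ∀ n : ℕ, ∃ m : ℕ, (m : ℝ) < 2 ^ n * r ∧ 2 ^ n * r ≤ m + 1 := by
    intro n
    have hpos : 0 < ⌈2 ^ n * r⌉₊ := Nat.ceil_pos.2 (by positivity)
    -- The ceiling minus one, rather than the floor, gives the strict lower bound even for dyadic
    -- `r`.
    refine ⟨⌈2 ^ n * r⌉₊ - 1, Nat.lt_ceil.1 (by omega), ?_⟩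
    have := Nat.le_ceil (2 ^ n * r)
    rw [Nat.cast_sub hpos]
    simpa using this
  choose m hlt hle using hm
  -- The bounds force `m (n + 1)` to be `2 * m n` or `2 * m n + 1`; its parity is the next digit.
  have heq : ∀ n, binVal (initSeg (fun k => decide (m (k + 1) % 2 = 1)) n) = m n := by
    intro n
    induction n with
    | zero =>
      have h : (m 0 : ℝ) < 1 := (hlt 0).trans_le (by simpa using h1)
      have h' : m 0 < 1 := by exact_mod_cast h
      simp [initSeg]
      omega
    | succ n ih =>
      rw [initSeg_succ, binVal_concat, ih]
      have e1 : (m (n + 1) : ℝ) < 2 * m n + 2 := by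
        have h1 := hlt (n + 1)
        have h2 := hle n
        rw [pow_succ] at h1
        linarith
      have e2 : (2 * m n : ℝ) < m (n + 1) + 1 := by
        have h1 := hle (n + 1)
        have h2 := hlt n
        rw [pow_succ] at h1
        linarith
      have e1' : m (n + 1) < 2 * m n + 2 := by exact_mod_cast e1
      have e2' : 2 * m n < m (n + 1) + 1 := by exact_mod_cast e2
      rcases Nat.mod_two_eq_zero_or_one (m (n + 1)) with h | h <;> simp [h] <;> omega
  exact ⟨_, fun n => by rw [heq]; exact ⟨hlt n, hle n⟩⟩

theorem sum_digits_eq (a : ℕ → Bool) (n : ℕ) :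
    ∑ k ∈ Finset.range n, (if a k then (1 / 2 : ℝ) ^ (k + 1) else 0) =
      binVal (initSeg a n) / 2 ^ n := by
  induction n with
  | zero => simp [initSeg]
  | succ n ih =>
    rw [Finset.sum_range_succ, ih, initSeg_succ, binVal_concat]
    cases a n <;> simp [pow_succ] <;> field_simp

/-- The tail after `n` digits lies between `0` and `2⁻ⁿ`. Both bounds are non-strict because tails
of all zeros and of all ones are allowed. -/
theorem isBinaryExpansion_iff {a : ℕ → Bool} {r : ℝ} :
    IsBinaryExpansion a r ↔
      ∀ n, (binVal (initSeg a n) : ℝ) ≤ 2 ^ n * r ∧ 2 ^ n * r ≤ binVal (initSeg a n) + 1 := by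
  have hnn : ∀ k, 0 ≤ (if a k then (1 / 2 : ℝ) ^ (k + 1) else 0) := fun k => by
    split_ifs <;> positivity
  rw [IsBinaryExpansion, hasSum_iff_tendsto_nat_of_nonneg hnn]
  simp_rw [sum_digits_eq]
  constructor
  · intro h n
    have hbd : ∀ j, (binVal (initSeg a n) : ℝ) / 2 ^ n ≤
        binVal (initSeg a (n + j)) / 2 ^ (n + j) ∧
        (binVal (initSeg a (n + j)) : ℝ) / 2 ^ (n + j) ≤ (binVal (initSeg a n) + 1) / 2 ^ n := by
      intro j
      obtain ⟨l, hl⟩ := initSeg_prefix a (Nat.le_add_right n j)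
      have hlen : l.length = j := by simpa using congrArg List.length hl
      have h1 : binVal (initSeg a n) * 2 ^ j ≤ binVal (initSeg a (n + j)) := by
        rw [← hl, binVal_append, hlen]; exact Nat.le_add_right _ _
      have h2 : binVal (initSeg a (n + j)) ≤ (binVal (initSeg a n) + 1) * 2 ^ j := by
        rw [← hl, ← hlen]; exact (binVal_append_lt _ _).le
      have h1' : (binVal (initSeg a n) : ℝ) * 2 ^ j ≤ binVal (initSeg a (n + j)) := by
        exact_mod_cast h1
      have h2' : (binVal (initSeg a (n + j)) : ℝ) ≤ (binVal (initSeg a n) + 1) * 2 ^ j := by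
        exact_mod_cast h2
      rw [pow_add, ← div_div]
      constructor
      · rw [div_right_comm, div_le_div_iff_of_pos_right (by positivity),
          le_div_iff₀ (by positivity)]
        exact h1'
      · rw [div_right_comm, div_le_div_iff_of_pos_right (by positivity),
          div_le_iff₀ (by positivity)]
        exact h2'
    have h' := (Filter.tendsto_add_atTop_iff_nat n).2 h
    simp_rw [add_comm _ n] at h'
    constructor
    · rw [← div_le_iff₀' (by positivity)]
      exact ge_of_tendsto' h' fun j => (hbd j).1
    · rw [← le_div_iff₀' (by positivity)]
      exact le_of_tendsto' h' fun j => (hbd j).2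
  · intro h
    have hlow : Filter.Tendsto (fun n : ℕ => r - (1 / 2 : ℝ) ^ n) Filter.atTop (nhds r) := by
      simpa using tendsto_const_nhds.sub
        (tendsto_pow_atTop_nhds_zero_of_lt_one (r := (1 / 2 : ℝ)) (by norm_num) (by norm_num))
    refine tendsto_of_tendsto_of_tendsto_of_le_of_le hlow tendsto_const_nhds ?_ ?_
    · intro n
      have := (h n).2
      simp only
      rw [one_div, inv_pow, le_div_iff₀ (by positivity), sub_mul,
        inv_mul_cancel₀ (by positivity)]
      linarith
    · intro n
      simp only
      rw [div_le_iff₀' (by positivity)]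
      exact (h n).1

theorem eq_of_lt_of_le_add_one {m n : ℕ} {r : ℝ} (h1 : (m : ℝ) < r) (h2 : r ≤ m + 1)
    (h3 : (n : ℝ) < r) (h4 : r ≤ n + 1) : m = n := by
  have h5 : (m : ℝ) < n + 1 := by linarith
  have h6 : (n : ℝ) < m + 1 := by linarith
  norm_cast at h5 h6
  omega

/-- For dyadic `r` the upper bound is an equality at `n`: the remaining tail has its full value
`2⁻ⁿ`, which only ones can supply. -/
theorem initSeg_add_of_dyadic {ω : ℕ → Bool} {r : ℝ}
    (hω : ∀ n, (binVal (initSeg ω n) : ℝ) < 2 ^ n * r ∧ 2 ^ n * r ≤ binVal (initSeg ω n) + 1)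
    {n j : ℕ} (hj : 2 ^ n * r = j) (k : ℕ) :
    initSeg ω (n + k) = initSeg ω n ++ List.replicate k true := by
  refine binVal_inj (by simp) (eq_of_lt_of_le_add_one (hω (n + k)).1 (hω (n + k)).2 ?_ ?_)
  all_goals
    have h := hω n
    rw [hj] at h
    have hj' : (j : ℝ) = binVal (initSeg ω n) + 1 := by
      have h1 : binVal (initSeg ω n) < j := by exact_mod_cast h.1
      have h2 : j ≤ binVal (initSeg ω n) + 1 := by exact_mod_cast h.2
      exact_mod_cast (by omega : j = binVal (initSeg ω n) + 1)
    have hk : (binVal (List.replicate k true) : ℝ) + 1 = 2 ^ k := by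
      exact_mod_cast binVal_replicate_true k
    have he : 2 ^ (n + k) * r = (binVal (initSeg ω n) + 1) * 2 ^ k := by
      rw [← hj', ← hj, pow_add]; ring
    rw [he, binVal_append]
    push_cast [List.length_replicate]
    linarith

/-- When `r` is not dyadic the lower bound of any expansion is strict, and a half-open interval of
length one contains only one integer. -/
theorem eq_of_isBinaryExpansion {ω a : ℕ → Bool} {r : ℝ}
    (hω : ∀ n, (binVal (initSeg ω n) : ℝ) < 2 ^ n * r ∧ 2 ^ n * r ≤ binVal (initSeg ω n) + 1)
    (hr : ∀ n j : ℕ, 2 ^ n * r ≠ j) (ha : IsBinaryExpansion a r) : a = ω := by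
  refine initSeg_inj fun n => binVal_inj (by simp) ?_
  have h := isBinaryExpansion_iff.1 ha n
  exact eq_of_lt_of_le_add_one (h.1.lt_of_ne (hr n _).symm) h.2 (hω n).1 (hω n).2

/-! ### Consequences of universality. -/

/-- A uniformly computable family of machines with prefix-free domains combines to one machine, in
which the `n`-th machine is selected by the self-delimiting code `0ⁿ1`. -/
theorem exists_machine_of_family {f : ℕ → List Bool → Option (List Bool)} (hf : Primrec₂ f)
    (hpf : ∀ n, IsPrefixFree {q | (f n q).isSome}) :
    ∃ A, IsPrefixMachine A ∧
      ∀ n q x, f n q = some x → x ∈ A (List.replicate n false ++ true :: q) := by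
  let F : List Bool → Option (List Bool) := fun p =>
    if p.idxOf true < p.length then f (p.idxOf true) (p.drop (p.idxOf true + 1)) else none
  have hidx : Primrec fun p : List Bool => p.idxOf true :=
    Primrec.list_idxOf.comp (.const true) .id
  have hF : Primrec F := Primrec.ite (Primrec.nat_lt.comp hidx Primrec.list_length)
    (hf.comp hidx (Primrec.list_drop.comp (Primrec.succ.comp hidx) .id)) (.const none)
  refine ⟨fun p => (F p : Part (List Bool)), ⟨hF.to_comp.ofOption, ?_⟩, ?_⟩
  · have hdom : ∀ p, p ∈ PFun.Dom (fun p => (F p : Part (List Bool))) →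
        p.idxOf true < p.length ∧ (f (p.idxOf true) (p.drop (p.idxOf true + 1))).isSome := by
      intro p hp
      have hp' : (F p).isSome := (Part.ofOption_dom (F p)).1 hp
      simp only [F] at hp'
      split_ifs at hp' with h
      · exact ⟨h, hp'⟩
      · simp at hp'
    rintro p hp - hq ⟨r, rfl⟩
    obtain ⟨h1, h2⟩ := hdom p hp
    obtain ⟨h3, h4⟩ := hdom _ hq
    -- An extension of `p` has its first `true` at the same place, so both programs select the same
    -- member of the family.
    rw [List.idxOf_append_of_mem (List.idxOf_lt_length_iff.1 h1),
      List.drop_append_of_le_length h1] at h4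
    simpa using hpf _ _ h2 _ h4 (List.prefix_append _ _)
  · intro n q x hx
    have hn : (List.replicate n false ++ true :: q).idxOf true = n := by
      rw [List.idxOf_append_of_notMem (by simp)]
      simp
    have hd : (List.replicate n false ++ true :: q).drop (n + 1) = q := by
      rw [List.drop_append]
      simp
    simp [F, hn, hd, hx]

theorem IsUniversalPrefixMachine.complexity_le_of_family {U : List Bool →. List Bool}
    (hU : IsUniversalPrefixMachine U) {f : ℕ → List Bool → Option (List Bool)} (hf : Primrec₂ f)
    (hpf : ∀ n, IsPrefixFree {q | (f n q).isSome}) :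
    ∃ c, ∀ n q x, f n q = some x → ∃ p, x ∈ U p ∧ p.length ≤ n + q.length + c := by
  obtain ⟨A, hA, hAf⟩ := exists_machine_of_family hf hpf
  obtain ⟨c, hc⟩ := hU.invariance A hA
  refine ⟨1 + c, fun n q x hx => exists_program_of_complexity_le ((hc x).trans ?_)⟩
  have := complexity_le (hAf n q x hx)
  refine (add_le_add_left this _).trans (le_of_eq ?_)
  norm_cast
  simp
  omega

/-- The `k`-th machine is defined only on the empty string, so the only cost is naming `k` in unary.
The factor `2` makes the output outgrow its program. -/
theorem IsUniversalPrefixMachine.complexity_append_replicate {U : List Bool →. List Bool}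
    (hU : IsUniversalPrefixMachine U) (w : List Bool) :
    ∃ c, ∀ k, ∃ p, w ++ List.replicate (2 * k) true ∈ U p ∧ p.length ≤ k + c := by
  let f : ℕ → List Bool → Option (List Bool) := fun k q =>
    if q = [] then some (w ++ List.replicate (2 * k) true) else none
  have hrep : Primrec fun k => List.replicate k true :=
    (Primrec.list_map Primrec.list_range (Primrec.const true).to₂).of_eq fun k => by
      simp [List.map_const']
  have hf : Primrec₂ f := Primrec.ite (Primrec.eq.comp Primrec.snd (.const []))
    (Primrec.option_some.comp (Primrec.list_append.comp (.const w)
      (hrep.comp (Primrec.nat_double.comp Primrec.fst)))) (.const none)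
  obtain ⟨c, hc⟩ := hU.complexity_le_of_family hf fun n p hp q hq _ => by
    simp only [f, Set.mem_ofPred_eq] at hp hq
    by_cases h1 : p = [] <;> by_cases h2 : q = [] <;> simp_all
  exact ⟨c, fun k => by simpa using hc k [] _ (if_pos rfl)⟩

theorem IsUniversalPrefixMachine.haltingProb_pos {U : List Bool →. List Bool}
    (hU : IsUniversalPrefixMachine U) : 0 < haltingProb U := by
  obtain ⟨c, hc⟩ := hU.complexity_append_replicate []
  obtain ⟨p, hp, -⟩ := hc 0
  have := hU.isPrefixMachine.sum_weight_le (T := {p}) fun q hq => by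
    rw [Finset.mem_singleton.1 hq]; exact Part.dom_iff_mem.2 ⟨_, hp⟩
  rw [Finset.sum_singleton] at this
  exact lt_of_lt_of_le (by unfold weight; positivity) this

theorem IsUniversalPrefixMachine.length_le_of_approx {U : List Bool →. List Bool}
    (hU : IsUniversalPrefixMachine U) : ∃ c, ∀ p x, x ∈ U p →
      (binVal x : ℝ) < 2 ^ x.length * haltingProb U →
      2 ^ x.length * haltingProb U ≤ binVal x + 1 → x.length ≤ p.length + c := by
  obtain ⟨A, hA, hAx⟩ := hU.isPrefixMachine.exists_machine_of_approx
  obtain ⟨c, hc⟩ := hU.invariance A hA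
  refine ⟨c, fun p x hx h1 h2 => ?_⟩
  obtain ⟨y, hy, hyU⟩ := hAx p x hx h1 h2
  have h3 : (x.length : ℕ∞) ≤ complexity U y := by
    simpa using le_complexity_add (c := 0) hyU
  have h4 := h3.trans ((hc y).trans (add_le_add_left (complexity_le hy) _))
  exact_mod_cast h4

theorem IsUniversalPrefixMachine.not_dyadic {U : List Bool →. List Bool}
    (hU : IsUniversalPrefixMachine U) {ω : ℕ → Bool}
    (hω : ∀ n, (binVal (initSeg ω n) : ℝ) < 2 ^ n * haltingProb U ∧
      2 ^ n * haltingProb U ≤ binVal (initSeg ω n) + 1) (n j : ℕ) :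
    2 ^ n * haltingProb U ≠ j := by
  intro hj
  obtain ⟨c, hc⟩ := hU.length_le_of_approx
  obtain ⟨d, hd⟩ := hU.complexity_append_replicate (initSeg ω n)
  -- With `k = c + d + 1`, incompressibility would give `n + 2k ≤ k + d + c`, which is false.
  obtain ⟨p, hp, hlen⟩ := hd (c + d + 1)
  rw [← initSeg_add_of_dyadic hω hj] at hp
  have := hc p _ hp (by simpa using (hω _).1) (by simpa using (hω _).2)
  rw [length_initSeg] at this
  omega

/-! ### Incompressibility implies randomness. -/

theorem primrec_covers {g : ℕ → ℕ × ℕ → Option (List Bool)} (hg : Primrec₂ g) :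
    PrimrecPred fun x : (ℕ × ℕ) × List Bool =>
      ∃ m < x.1.2, ((g x.1.2 (x.1.1, m)).map fun v => decide (v <+: x.2)).getD false = true := by
  have hR : PrimrecRel fun (m : ℕ) (x : (ℕ × ℕ) × List Bool) =>
      ((g x.1.2 (x.1.1, m)).map fun v => decide (v <+: x.2)).getD false = true := by
    refine Primrec.eq.comp (Primrec.option_getD.comp (Primrec.option_map ?_ ?_) (.const false))
      (.const true)
    · exact hg.comp (Primrec.snd.comp (Primrec.fst.comp Primrec.snd))
        ((Primrec.fst.comp (Primrec.fst.comp Primrec.snd)).pair Primrec.fst)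
    · exact (primrec_prefix.comp Primrec.snd
        (Primrec.snd.comp (Primrec.snd.comp Primrec.fst))).decide.to₂
  exact (hR.exists_mem_list.comp (Primrec.list_range.comp (Primrec.snd.comp Primrec.fst))
    Primrec.id).of_eq fun x => by simp

/-- The strings listed by `coverList` give rise to a prefix-free set of codes: the `N`-th new string of
length `t` gets the number `N`, written with `t - k` binary digits. -/
theorem isPrefixFree_codes (C : ℕ → List Bool → Bool) (k : ℕ) :
    IsPrefixFree {q | 2 * (coverList C (q.length + k - 1)).length ≤ binVal q ∧
      binVal q < (coverList C (q.length + k)).length} := by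
  rintro q ⟨-, h1⟩ _ ⟨h2, -⟩ ⟨r, rfl⟩
  rcases Nat.eq_zero_or_pos r.length with hr | hr
  · rw [List.length_eq_zero_iff.1 hr, List.append_nil]
  exfalso
  obtain ⟨j, hj⟩ := Nat.exists_eq_add_of_lt hr
  -- At code length `e` the allowed numerals, scaled by `2⁻ᵉ`, start at the scaled end of the range
  -- for length `e - 1`. The ranges for different lengths are thus disjoint, and an extension of `q`
  -- stays within the dyadic interval of `q`.
  rw [List.length_append, show q.length + r.length + k - 1 = q.length + k + j by omega] at h2
  have h3 := pow_mul_length_coverList_le C (q.length + k) j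
  have h4 := binVal_append_lt q r
  have h5 : (binVal q + 1) * 2 ^ r.length ≤
      (coverList C (q.length + k)).length * 2 ^ r.length := Nat.mul_le_mul_right _ h1
  rw [hj, zero_add, pow_succ] at h4 h5
  nlinarith

/-- A sequence whose initial segments are incompressible is Martin-Löf random. -/
theorem IsUniversalPrefixMachine.isMartinLofRandom {U : List Bool →. List Bool}
    (hU : IsUniversalPrefixMachine U) {ω : ℕ → Bool} {c : ℕ}
    (hc : ∀ n p, initSeg ω n ∈ U p → n ≤ p.length + c) : IsMartinLofRandom ω := by
  rintro X ⟨u, hu, hX, hμ⟩ hω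
  obtain ⟨g, hg, hmono, hspec⟩ := exists_primrec_approx hu
  obtain ⟨hdec, hC⟩ := primrec_covers hg
  let C : ℕ → ℕ → List Bool → Bool := fun n t z => decide (∃ m < t,
    ((g t (n, m)).map fun v => decide (v <+: z)).getD false = true)
  have hCiff : ∀ n t z, C n t z ↔ ∃ m < t, ∃ v, g t (n, m) = some v ∧ v <+: z := by
    intro n t z
    simp only [C, decide_eq_true_eq]
    refine exists_congr fun m => and_congr_right fun _ => ?_
    cases g t (n, m) <;> simp
  have hE : Primrec₂ fun n t => coverList (C n) t :=
    primrec_coverList (hC.of_eq fun x => by simp [C])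
  have hcard : ∀ n t, (coverList (C n) t).length * 2 ^ n ≤ 2 ^ t := by
    intro n t
    refine length_mul_le_of_extensions_subset (nodup_coverList _ t)
      (fun z => length_of_mem_coverList) (fun z hz a ha => ?_) (hμ n)
    obtain ⟨k, -, y, hy, hCk⟩ := exists_prefix_of_mem_coverList hz
    obtain ⟨m, -, v, hv, hvy⟩ := (hCiff n k y).1 hCk
    exact Set.mem_iUnion.2 ⟨m, Set.mem_iUnion₂.2 ⟨v, (hspec (n, m) v).2 ⟨k, hv⟩,
      mem_extensions_of_prefix (hvy.trans hy) ha⟩⟩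
  -- Level `2 * n` saves `2n` bits, of which naming `n` in unary spends only about half.
  let f : ℕ → List Bool → Option (List Bool) := fun n q =>
    if 2 * (coverList (C (2 * n)) (q.length + 2 * n - 1)).length ≤ binVal q then
      (coverList (C (2 * n)) (q.length + 2 * n))[binVal q]? else none
  have hf : Primrec₂ f := by
    have hd : Primrec fun x : ℕ × List Bool => 2 * x.1 := Primrec.nat_double.comp Primrec.fst
    have ht : Primrec fun x : ℕ × List Bool => x.2.length + 2 * x.1 :=
      Primrec.nat_add.comp (Primrec.list_length.comp Primrec.snd) hd
    have hv : Primrec fun x : ℕ × List Bool => binVal x.2 := primrec_binVal.comp Primrec.snd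
    exact Primrec.ite (Primrec.nat_le.comp (Primrec.nat_double.comp (Primrec.list_length.comp
      (hE.comp hd (Primrec.nat_sub.comp ht (.const 1))))) hv)
      (Primrec.list_getElem?.comp (hE.comp hd ht) hv) (.const none)
  obtain ⟨d, hd⟩ := hU.complexity_le_of_family hf fun n p hp q hq hpq => by
    have hsub : ∀ q, (f n q).isSome →
        2 * (coverList (C (2 * n)) (q.length + 2 * n - 1)).length ≤ binVal q ∧
        binVal q < (coverList (C (2 * n)) (q.length + 2 * n)).length := by
      intro q hq
      simp only [f] at hq
      split_ifs at hq with h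
      · exact ⟨h, by simpa using hq⟩
      · simp at hq
    exact isPrefixFree_codes (C (2 * n)) (2 * n) p (hsub p hp) q (hsub q hq) hpq
  -- The net saving of `n` bits must exceed the overhead `d` of the code plus the slack `c`.
  obtain ⟨n, hn⟩ : ∃ n, n = c + d + 1 := ⟨_, rfl⟩
  have hex : ∃ t, initSeg ω t ∈ coverList (C (2 * n)) t := by
    obtain ⟨m, hm⟩ := Set.mem_iUnion.1 (Set.mem_iInter.1 (hX hω) (2 * n))
    obtain ⟨v, hv, hωv⟩ := Set.mem_iUnion₂.1 hm
    obtain ⟨s, hs⟩ := (hspec (2 * n, m) v).1 hv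
    refine ⟨s + m + v.length + 1, mem_coverList_succ.2 ⟨by simp, .inr ?_⟩⟩
    refine (hCiff _ _ _).2 ⟨m, by omega, v, hmono s _ _ _ (by omega) hs, ?_⟩
    have hωv' : initSeg ω v.length = v := hωv
    have := initSeg_prefix ω (show v.length ≤ s + m + v.length + 1 by omega)
    rwa [hωv'] at this
  classical
  -- At the first length where `ω` is covered, the parent segment is unlisted; this puts the segment
  -- among the new entries. That length is positive because the list at `0` is empty.
  obtain ⟨t, ht⟩ : ∃ t, t + 1 = Nat.find hex := by
    refine ⟨Nat.find hex - 1, Nat.sub_add_cancel (Nat.one_le_iff_ne_zero.2 fun h0 => ?_)⟩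
    have := Nat.find_spec hex
    rw [h0] at this
    simp [coverList] at this
  have hmem : initSeg ω (t + 1) ∈ coverList (C (2 * n)) (t + 1) := ht ▸ Nat.find_spec hex
  have hnot : initSeg ω t ∉ coverList (C (2 * n)) t := Nat.find_min hex (by omega)
  obtain ⟨N, hN⟩ := List.mem_iff_getElem?.1 hmem
  have hidx := le_index_coverList hN (by simpa [initSeg_succ] using hnot)
  obtain ⟨hNlt, -⟩ := List.getElem?_eq_some_iff.1 hN
  have hlt : N * 2 ^ (2 * n) < 2 ^ (t + 1) :=
    (Nat.mul_lt_mul_of_pos_right hNlt (by positivity)).trans_le (hcard _ _)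
  have hle : 2 * n ≤ t + 1 := by
    refine (Nat.pow_le_pow_iff_right (a := 2) (by norm_num)).1 ?_
    exact (Nat.le_mul_of_pos_left _ (by omega)).trans (hcard (2 * n) (t + 1))
  obtain ⟨e, he⟩ := Nat.exists_eq_add_of_le' hle
  -- The measure bound makes the index `N` fit into `e = t + 1 - 2n` digits.
  obtain ⟨q, hq, hqN⟩ := exists_binVal_eq e N (by
    rw [he, pow_add] at hlt
    exact lt_of_mul_lt_mul_right hlt (by positivity))
  obtain ⟨p, hp, hplen⟩ := hd n q (initSeg ω (t + 1)) (by
    simp only [f]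
    rw [hq, hqN, ← he, Nat.add_sub_cancel, if_pos hidx, hN])
  have := hc _ p hp
  omega

end AlgRandom

theorem mainTheorem4 (U : List Bool →. List Bool) (hU : AlgRandom.IsUniversalPrefixMachine U) :
    Summable (fun p : U.Dom => AlgRandom.weight p) ∧
    ∃ ω : ℕ → Bool,
      (∀ a : ℕ → Bool, AlgRandom.IsBinaryExpansion a (AlgRandom.haltingProb U) ↔ a = ω) ∧
      AlgRandom.IsMartinLofRandom ω ∧
      ∃ c : ℕ, ∀ k : ℕ,
        (k : ℕ∞) ≤ AlgRandom.complexity U (AlgRandom.initSeg ω (k + 1)) + c := by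
  have hpf := hU.isPrefixMachine.prefixFree
  obtain ⟨ω, hω⟩ := AlgRandom.exists_initSeg_approx hU.haltingProb_pos hpf.tsum_weight_le_one
  obtain ⟨c, hc⟩ := hU.length_le_of_approx
  have hc' : ∀ n p, AlgRandom.initSeg ω n ∈ U p → n ≤ p.length + c := fun n p hp => by
    simpa using hc p _ hp (by simpa using (hω n).1) (by simpa using (hω n).2)
  refine ⟨hpf.summable_weight, ω, fun a => ⟨fun ha => ?_, ?_⟩, hU.isMartinLofRandom hc', c,
    fun k => AlgRandom.le_complexity_add fun p hp => (Nat.le_succ k).trans (hc' _ p hp)⟩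
  · exact AlgRandom.eq_of_isBinaryExpansion hω (hU.not_dyadic hω) ha
  · rintro rfl
    exact AlgRandom.isBinaryExpansion_iff.2 fun n => ⟨(hω n).1.le, (hω n).2⟩
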